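/- Let $n\ge 3$, let $\Omega\subset\mathbb R^n$ be a bounded domain with $C^\infty$ boundary, and let $\gamma$ be a bounded measurable function from $\overline\Omega$ to the positive-definite symmetric $n\times n$ real matrices. Let $\Psi:\overline\Omega\to\overline\Omega$ be a diffeomorphism ($C^1$ up to the boundary together with its inverse) with $|\det D\Psi|=1$ on $\Omega$ and $\Psi|_{\partial\Omega}=\mathrm{Id}$, and put $$\Psi_*\gamma=\left(\frac{D\Psi\,\gamma\,(D\Psi)^T}{|\det D\Psi|}\right)\circ\Psi^{-1}.$$ For a conductivity $\beta$ on $\overline\Omega$ and $\lambda\in\mathbb R$, a weak solution of $-\mathrm{div}(\beta\nabla u)=\lambda u$ in $\Omega$, $u=f$ on $\partial\Omega$ (with $f\in H^{1/2}(\partial\Omega)$) is a $u\in H^1(\Omega)$ with trace $f$ and $\int_\Omega\beta\nabla u\cdot\nabla v\,dx=\lambda\int_\Omega uv\,dx$ for all $v\in H^1_0(\Omega)$. The Dirichlet-to-Neumann map $\Lambda_{\beta,\lambda}:H^{1/2}(\partial\Omega)\to H^{-1/2}(\partial\Omega)$ is defined by $$\langle\Lambda_{\beta,\lambda}f\,|\,g\rangle=\int_\Omega\beta\nabla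 u\cdot\nabla v\,dx-\lambda\int_\Omega uv\,dx\qquad(g\in H^{1/2}(\partial\Omega)),$$ where $u$ is the weak solution with boundary value $f$ and $v$ is any element of $H^1(\Omega)$ with trace $g$; if $\lambda$ lies in the Dirichlet spectrum of $L_\beta=-\mathrm{div}(\beta\nabla\,\cdot)$, the same formula, with $u$ running over all weak solutions with boundary value $f$, defines a relation (the set of Cauchy data) instead of a map. The Dirichlet spectrum is the set of real $\lambda$ for which $L_\beta-\lambda$, as an operator in $L^2(\Omega)$ with domain $\{u\in H^1_0(\Omega): L_\beta u\in L^2(\Omega)\}$, is not a bijection onto $L^2(\Omega)$. Then $L_{\Psi_*\gamma}$ and $L_\gamma$ have the same Dirichlet spectrum, and for every $\lambda\in\mathbb R$ the graphs of $\Lambda_{\Psi_*\gamma,\lambda}$ and $\Lambda_{\gamma,\lambda}$ (as relations between $H^{1/2}(\partial\Omega)$ and $H^{-1/2}(\partial\Omega)$) coincide; in particular, for every $\lambda$ outside the Dirichlet spectrum of $L_\gamma$, $$\Lambda_{\Psi_*\gamma,\lambda}=\Lambda_{\gamma,\lambda}.$$ -/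

import Mathlib

open MeasureTheory Set
open scoped ContDiff

noncomputable section

namespace DNGauge

/-- Euclidean space `ℝⁿ`. -/
abbrev E (n : ℕ) : Type := EuclideanSpace ℝ (Fin n)

/-! ### Domains, conductivities, diffeomorphisms -/

/-- `Ω` is a bounded domain with `C^∞` boundary: near each boundary point it is the strict sublevel
set `{ρ < 0}` of a smooth function `ρ` with nowhere vanishing differential. -/
structure IsSmoothBoundedDomain {n : ℕ} (Ω : Set (E n)) : Prop where
  isOpen : IsOpen Ω
  isConnected : IsConnected Ω
  isBounded : Bornology.IsBounded Ω
  smooth_boundary : ∀ x ∈ frontier Ω, ∃ (U : Set (E n)) (ρ : E n → ℝ),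
    IsOpen U ∧ x ∈ U ∧ ContDiffOn ℝ ∞ ρ U ∧ (∀ y ∈ U, fderiv ℝ ρ y ≠ 0) ∧
      Ω ∩ U = {y ∈ U | ρ y < 0}

/-- A conductivity on `Ω̄`: a bounded measurable function from `Ω̄` to the positive-definite
symmetric matrices. Values outside `Ω̄` are irrelevant. -/
structure IsConductivity {n : ℕ} (Ω : Set (E n)) (γ : E n → Matrix (Fin n) (Fin n) ℝ) : Prop where
  measurable : ∀ i j, Measurable fun x : closure Ω => γ x i j
  bounded : ∃ C : ℝ, ∀ x ∈ closure Ω, ∀ i j, |γ x i j| ≤ C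
  posDef : ∀ x ∈ closure Ω, (γ x).PosDef

/-- The Jacobian matrix `DΨ(x)` of a map on `Ω̄`, `(DΨ(x))ᵢⱼ = ∂ⱼΨᵢ(x)`. At points of the open set
`Ω` the derivative within `Ω̄` is the ordinary derivative. -/
def jacobian {n : ℕ} (Ω : Set (E n)) (Ψ : E n → E n) (x : E n) : Matrix (Fin n) (Fin n) ℝ :=
  LinearMap.toMatrix (EuclideanSpace.basisFun (Fin n) ℝ).toBasis
    (EuclideanSpace.basisFun (Fin n) ℝ).toBasis
    (fderivWithin ℝ Ψ (closure Ω) x).toLinearMap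

/-- The inverse `Ψ⁻¹ : Ω̄ → Ω̄` of a bijection `Ψ` of `Ω̄`. -/
def inverseOn {n : ℕ} (Ω : Set (E n)) (Ψ : E n → E n) : E n → E n :=
  Function.invFunOn Ψ (closure Ω)

/-- `Ψ ∈ SDiff(Ω̄)`: a diffeomorphism of `Ω̄` onto itself (`C¹` up to the boundary together with
its inverse; this includes diffeomorphisms of any higher regularity) with `|det DΨ| = 1` on `Ω`
and `Ψ = Id` on `∂Ω`. -/
structure IsSDiff {n : ℕ} (Ω : Set (E n)) (Ψ : E n → E n) : Prop where
  bijOn : BijOn Ψ (closure Ω) (closure Ω)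
  contDiffOn : ContDiffOn ℝ 1 Ψ (closure Ω)
  contDiffOn_inverse : ContDiffOn ℝ 1 (inverseOn Ω Ψ) (closure Ω)
  abs_det : ∀ x ∈ Ω, |(jacobian Ω Ψ x).det| = 1
  boundary : ∀ x ∈ frontier Ω, Ψ x = x

/-- `Ψ_*γ = (DΨ γ (DΨ)ᵀ / |det DΨ|) ∘ Ψ⁻¹`. -/
def pushforward {n : ℕ} (Ω : Set (E n)) (Ψ : E n → E n) (γ : E n → Matrix (Fin n) (Fin n) ℝ) :
    E n → Matrix (Fin n) (Fin n) ℝ := fun y =>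
  let x := inverseOn Ω Ψ y
  |(jacobian Ω Ψ x).det|⁻¹ • (jacobian Ω Ψ x * γ x * (jacobian Ω Ψ x).transpose)

/-! ### Sobolev spaces and traces -/

/-- `φ ∈ C_c^∞(Ω)`. -/
structure IsTestFunction {n : ℕ} (Ω : Set (E n)) (φ : E n → ℝ) : Prop where
  smooth : ContDiff ℝ ∞ φ
  compact : HasCompactSupport φ
  support : tsupport φ ⊆ Ω

/-- `L²(Ω; F)`. -/
abbrev L2 {n : ℕ} (Ω : Set (E n)) (F : Type) [NormedAddCommGroup F] : Type :=
  Lp F 2 ((volume : Measure (E n)).restrict Ω)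

/-- `G` is the weak (distributional) gradient of `u` on `Ω`. -/
def IsWeakGradient {n : ℕ} (Ω : Set (E n)) (u : E n → ℝ) (G : E n → E n) : Prop :=
  ∀ φ : E n → ℝ, IsTestFunction Ω φ → ∀ i : Fin n,
    ∫ x in Ω, u x * fderiv ℝ φ x (EuclideanSpace.single i 1) = - ∫ x in Ω, G x i * φ x

theorem IsTestFunction.memLp {n : ℕ} {Ω : Set (E n)} {φ : E n → ℝ} (h : IsTestFunction Ω φ) :
    MemLp φ 2 ((volume : Measure (E n)).restrict Ω) :=
  (h.smooth.continuous.memLp_of_hasCompactSupport h.compact).restrict _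

theorem IsTestFunction.memLp_fderiv {n : ℕ} {Ω : Set (E n)} {φ : E n → ℝ}
    (h : IsTestFunction Ω φ) (w : E n) :
    MemLp (fun x => fderiv ℝ φ x w) 2 ((volume : Measure (E n)).restrict Ω) := by
  refine (Continuous.memLp_of_hasCompactSupport ?_ (h.compact.fderiv_apply (𝕜 := ℝ) w)).restrict _
  exact (h.smooth.continuous_fderiv (by simp)).clm_apply continuous_const

theorem memLp_coord {n : ℕ} {Ω : Set (E n)} (G : L2 Ω (E n)) (i : Fin n) :
    MemLp (fun x => G x i) 2 ((volume : Measure (E n)).restrict Ω) :=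
  (EuclideanSpace.proj i : E n →L[ℝ] ℝ).comp_memLp' (Lp.memLp G)

/-- `H¹(Ω)`, realised as the set of pairs `(u, ∇u) ∈ L²(Ω) × L²(Ω; ℝⁿ)` with `∇u` the weak gradient
of `u`. The norm inherited from the product is equivalent to the usual `H¹` norm. -/
def H1 {n : ℕ} (Ω : Set (E n)) : Submodule ℝ (L2 Ω ℝ × L2 Ω (E n)) where
  carrier := {p | IsWeakGradient Ω p.1 p.2}
  zero_mem' := by
    intro φ _ i
    have h1 : ∫ x in Ω, (0 : L2 Ω ℝ) x * fderiv ℝ φ x (EuclideanSpace.single i 1) = 0 := by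
      rw [← integral_zero (E n) ℝ (μ := volume.restrict Ω)]
      refine integral_congr_ae ?_
      filter_upwards [Lp.coeFn_zero ℝ 2 ((volume : Measure (E n)).restrict Ω)] with x hx
      rw [hx]; simp
    have h2 : ∫ x in Ω, (0 : L2 Ω (E n)) x i * φ x = 0 := by
      rw [← integral_zero (E n) ℝ (μ := volume.restrict Ω)]
      refine integral_congr_ae ?_
      filter_upwards [Lp.coeFn_zero (E n) 2 ((volume : Measure (E n)).restrict Ω)] with x hx
      rw [hx]; simp
    simp only [Prod.fst_zero, Prod.snd_zero]
    rw [h1, h2, neg_zero]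
  add_mem' := by
    rintro ⟨u, G⟩ ⟨v, H⟩ hu hv φ hφ i
    have h1 : ∫ x in Ω, (u + v : L2 Ω ℝ) x * fderiv ℝ φ x (EuclideanSpace.single i 1) =
        ∫ x in Ω, (u x * fderiv ℝ φ x (EuclideanSpace.single i 1) +
          v x * fderiv ℝ φ x (EuclideanSpace.single i 1)) := by
      refine integral_congr_ae ?_
      filter_upwards [Lp.coeFn_add u v] with x hx
      rw [hx]; simp [add_mul]
    have h2 : ∫ x in Ω, (G + H : L2 Ω (E n)) x i * φ x =
        ∫ x in Ω, (G x i * φ x + H x i * φ x) := by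
      refine integral_congr_ae ?_
      filter_upwards [Lp.coeFn_add G H] with x hx
      rw [hx]; simp [add_mul]
    have hu' := hu φ hφ i
    have hv' := hv φ hφ i
    simp only [Prod.mk_add_mk] at *
    have i1 : ∀ w : L2 Ω ℝ, Integrable
        (fun x => w x * fderiv ℝ φ x (EuclideanSpace.single i 1)) (volume.restrict Ω) :=
      fun w => (Lp.memLp w).integrable_mul (hφ.memLp_fderiv _)
    have i2 : ∀ K : L2 Ω (E n), Integrable (fun x => K x i * φ x) (volume.restrict Ω) :=
      fun K => (memLp_coord K i).integrable_mul hφ.memLp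
    rw [h1, h2, integral_add (i1 u) (i1 v), integral_add (i2 G) (i2 H), hu', hv', neg_add]
  smul_mem' := by
    rintro c ⟨u, G⟩ hu φ hφ i
    have h1 : ∫ x in Ω, (c • u : L2 Ω ℝ) x * fderiv ℝ φ x (EuclideanSpace.single i 1) =
        ∫ x in Ω, c * (u x * fderiv ℝ φ x (EuclideanSpace.single i 1)) := by
      refine integral_congr_ae ?_
      filter_upwards [Lp.coeFn_smul c u] with x hx
      rw [hx]; simp [mul_assoc]
    have h2 : ∫ x in Ω, (c • G : L2 Ω (E n)) x i * φ x = ∫ x in Ω, c * (G x i * φ x) := by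
      refine integral_congr_ae ?_
      filter_upwards [Lp.coeFn_smul c G] with x hx
      rw [hx]; simp [mul_assoc]
    have hu' := hu φ hφ i
    simp only [Prod.smul_mk] at *
    rw [h1, h2, integral_const_mul, integral_const_mul, hu', mul_neg]

/-- The underlying function of an element of `H¹(Ω)`. -/
abbrev fn {n : ℕ} {Ω : Set (E n)} (u : H1 Ω) : L2 Ω ℝ := u.1.1

/-- The weak gradient of an element of `H¹(Ω)`. -/
abbrev grad {n : ℕ} {Ω : Set (E n)} (u : H1 Ω) : L2 Ω (E n) := u.1.2

/-- `u ∈ H¹(Ω)` is represented on `Ω` by the classically differentiable function `φ`. -/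
def Represents {n : ℕ} {Ω : Set (E n)} (φ : E n → ℝ) (u : H1 Ω) : Prop :=
  (∀ᵐ x ∂(volume : Measure (E n)).restrict Ω, fn u x = φ x) ∧
    ∀ᵐ x ∂(volume : Measure (E n)).restrict Ω, HasGradientAt φ (grad u x) x

theorem represents_zero {n : ℕ} {Ω : Set (E n)} : Represents (Ω := Ω) (fun _ => 0) (0 : H1 Ω) := by
  constructor
  · filter_upwards [Lp.coeFn_zero ℝ 2 ((volume : Measure (E n)).restrict Ω)] with x hx
    have : fn (0 : H1 Ω) x = 0 := hx
    rw [this]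
  · filter_upwards [Lp.coeFn_zero (E n) 2 ((volume : Measure (E n)).restrict Ω)] with x hx
    have : grad (0 : H1 Ω) x = 0 := hx
    rw [this]
    exact hasGradientAt_const x 0

theorem Represents.add {n : ℕ} {Ω : Set (E n)} {φ ψ : E n → ℝ} {u v : H1 Ω}
    (hu : Represents φ u) (hv : Represents ψ v) :
    Represents (fun x => φ x + ψ x) (u + v) := by
  constructor
  · filter_upwards [hu.1, hv.1, Lp.coeFn_add (fn u) (fn v)] with x h1 h2 h3
    have : fn (u + v) x = fn u x + fn v x := h3
    rw [this, h1, h2]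
  · filter_upwards [hu.2, hv.2, Lp.coeFn_add (grad u) (grad v)] with x h1 h2 h3
    have : grad (u + v) x = grad u x + grad v x := h3
    rw [this, hasGradientAt_iff_hasFDerivAt, map_add]
    exact h1.hasFDerivAt.add h2.hasFDerivAt

theorem Represents.smul {n : ℕ} {Ω : Set (E n)} {φ : E n → ℝ} {u : H1 Ω} (c : ℝ)
    (hu : Represents φ u) : Represents (fun x => c * φ x) (c • u) := by
  constructor
  · filter_upwards [hu.1, Lp.coeFn_smul c (fn u)] with x h1 h3
    have : fn (c • u) x = c * fn u x := h3
    rw [this, h1]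
  · filter_upwards [hu.2, Lp.coeFn_smul c (grad u)] with x h1 h3
    have : grad (c • u) x = c • grad u x := h3
    rw [this, hasGradientAt_iff_hasFDerivAt, map_smul]
    exact h1.hasFDerivAt.const_mul c

/-- `C_c^∞(Ω)` as a subspace of `H¹(Ω)`. -/
def testSpace {n : ℕ} (Ω : Set (E n)) : Submodule ℝ (H1 Ω) where
  carrier := {u | ∃ φ, IsTestFunction Ω φ ∧ Represents φ u}
  zero_mem' := ⟨fun _ => 0, ⟨contDiff_const, HasCompactSupport.zero, by
    rw [show (fun _ : E n => (0 : ℝ)) = 0 from rfl, tsupport_zero]; exact empty_subset _⟩,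
    represents_zero⟩
  add_mem' := by
    rintro u v ⟨φ, hφ, hu⟩ ⟨ψ, hψ, hv⟩
    exact ⟨_, ⟨hφ.smooth.add hψ.smooth, hφ.compact.add hψ.compact,
      (tsupport_add φ ψ).trans (union_subset hφ.support hψ.support)⟩, hu.add hv⟩
  smul_mem' := by
    rintro c u ⟨φ, hφ, hu⟩
    exact ⟨_, ⟨contDiff_const.mul hφ.smooth, hφ.compact.mul_left,
      (tsupport_mul_subset_right (f := fun _ => c)).trans hφ.support⟩, hu.smul c⟩

/-- `H¹₀(Ω)`, the closure of `C_c^∞(Ω)` in `H¹(Ω)`. -/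
def H10 {n : ℕ} (Ω : Set (E n)) : Submodule ℝ (H1 Ω) := (testSpace Ω).topologicalClosure

/-- The surface measure on `∂Ω`: `(n-1)`-dimensional Hausdorff measure restricted to `∂Ω`. -/
def surfaceMeasure {n : ℕ} (Ω : Set (E n)) : Measure (E n) :=
  (Measure.hausdorffMeasure ((n : ℝ) - 1)).restrict (frontier Ω)

/-- `L²(∂Ω)`. -/
abbrev L2Boundary {n : ℕ} (Ω : Set (E n)) : Type := Lp ℝ 2 (surfaceMeasure Ω)

/-- The graph of the restriction map `φ ↦ φ|_∂Ω` on `C¹(Ω̄)`. -/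
def restrictionGraph {n : ℕ} (Ω : Set (E n)) : Submodule ℝ (H1 Ω × L2Boundary Ω) where
  carrier := {p | ∃ φ : E n → ℝ, ContDiffOn ℝ 1 φ (closure Ω) ∧ Represents φ p.1 ∧
    ∀ᵐ x ∂(surfaceMeasure Ω), p.2 x = φ x}
  zero_mem' := ⟨fun _ => 0, contDiffOn_const, represents_zero, by
    filter_upwards [Lp.coeFn_zero ℝ 2 (surfaceMeasure Ω)] with x hx
    exact hx⟩
  add_mem' := by
    rintro ⟨u, f⟩ ⟨v, g⟩ ⟨φ, hφ, hu, hf⟩ ⟨ψ, hψ, hv, hg⟩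
    refine ⟨_, hφ.add hψ, hu.add hv, ?_⟩
    filter_upwards [hf, hg, Lp.coeFn_add f g] with x h1 h2 h3
    simp only [Prod.mk_add_mk] at *
    rw [h3, Pi.add_apply, h1, h2]
  smul_mem' := by
    rintro c ⟨u, f⟩ ⟨φ, hφ, hu, hf⟩
    refine ⟨_, contDiffOn_const.mul hφ, hu.smul c, ?_⟩
    filter_upwards [hf, Lp.coeFn_smul c f] with x h1 h3
    simp only [Prod.smul_mk] at *
    rw [h3, Pi.smul_apply, h1, smul_eq_mul]

/-- The graph of the trace operator `H¹(Ω) → L²(∂Ω)`, the continuous extension of the restriction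
map on `C¹(Ω̄)`: its graph is the closure of the graph of the latter. -/
def traceGraph {n : ℕ} (Ω : Set (E n)) : Submodule ℝ (H1 Ω × L2Boundary Ω) :=
  (restrictionGraph Ω).topologicalClosure

/-- `u|_∂Ω = f` in the sense of traces. -/
def IsTrace {n : ℕ} (Ω : Set (E n)) (u : H1 Ω) (f : L2Boundary Ω) : Prop :=
  (u, f) ∈ traceGraph Ω

/-- `H^{1/2}(∂Ω)`, the space of traces of functions in `H¹(Ω)`. -/
def HHalf {n : ℕ} (Ω : Set (E n)) : Submodule ℝ (L2Boundary Ω) :=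
  (traceGraph Ω).map (LinearMap.snd ℝ (H1 Ω) (L2Boundary Ω))

/-- `H^{-1/2}(∂Ω)`, the space of linear functionals on `H^{1/2}(∂Ω)` that are bounded for the trace
norm `‖g‖ = inf {‖v‖_{H¹} : v|_∂Ω = g}`. -/
def HMinusHalf {n : ℕ} (Ω : Set (E n)) : Submodule ℝ (Module.Dual ℝ (HHalf Ω)) where
  carrier := {l | ∃ C : ℝ, ∀ (v : H1 Ω) (g : HHalf Ω), IsTrace Ω v g → |l g| ≤ C * ‖v‖}
  zero_mem' := ⟨0, fun v g _ => by simp⟩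
  add_mem' := by
    rintro l m ⟨C, hC⟩ ⟨D, hD⟩
    refine ⟨C + D, fun v g h => ?_⟩
    have := abs_add_le (l g) (m g)
    have h1 := hC v g h
    have h2 := hD v g h
    rw [LinearMap.add_apply]
    linarith
  smul_mem' := by
    rintro c l ⟨C, hC⟩
    refine ⟨|c| * C, fun v g h => ?_⟩
    rw [LinearMap.smul_apply, smul_eq_mul, abs_mul, mul_assoc]
    exact mul_le_mul_of_nonneg_left (hC v g h) (abs_nonneg c)

/-! ### The Dirichlet problem and the Dirichlet-to-Neumann map -/

/-- `∫_Ω γ∇u · ∇v dx`. -/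
def energy {n : ℕ} (Ω : Set (E n)) (γ : E n → Matrix (Fin n) (Fin n) ℝ) (u v : H1 Ω) : ℝ :=
  ∫ x in Ω, dotProduct ((γ x).mulVec (grad u x).ofLp) (grad v x).ofLp

/-- `∫_Ω u v dx`. -/
def pairing {n : ℕ} (Ω : Set (E n)) (u v : L2 Ω ℝ) : ℝ := ∫ x in Ω, u x * v x

/-- `u ∈ H¹(Ω)` is a weak solution of `-div(γ∇u) = λu` in `Ω`, `u = f` on `∂Ω`. -/
structure IsWeakSolution {n : ℕ} (Ω : Set (E n)) (γ : E n → Matrix (Fin n) (Fin n) ℝ) (lam : ℝ)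
    (f : HHalf Ω) (u : H1 Ω) : Prop where
  equation : ∀ v ∈ H10 Ω, energy Ω γ u v = lam * pairing Ω (fn u) (fn v)
  trace : IsTrace Ω u f

/-- The (real) Dirichlet spectrum of `L_γ = -div(γ∇·)`, regarded as an operator in `L²(Ω)` with
domain `{u ∈ H¹₀(Ω) : L_γ u ∈ L²(Ω)}`: the set of `λ` for which `L_γ - λ` is not a bijection from
its domain onto `L²(Ω)`. -/
def dirichletSpectrum {n : ℕ} (Ω : Set (E n)) (γ : E n → Matrix (Fin n) (Fin n) ℝ) : Set ℝ :=
  {lam | ¬ ∀ h : L2 Ω ℝ, ∃! u : H1 Ω, u ∈ H10 Ω ∧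
    ∀ v ∈ H10 Ω, energy Ω γ u v - lam * pairing Ω (fn u) (fn v) = pairing Ω h (fn v)}

/-- The graph of the Dirichlet-to-Neumann map `Λ_{γ,λ} : H^{1/2}(∂Ω) → H^{-1/2}(∂Ω)`: the pairs
`(f, Λf)` such that, for a weak solution `u` with boundary value `f`,
`⟨Λf | g⟩ = ∫_Ω γ∇u · ∇v dx - λ ∫_Ω u v dx` for all `g ∈ H^{1/2}(∂Ω)` and all `v ∈ H¹(Ω)` with
`v|_∂Ω = g`. For `λ` in the Dirichlet spectrum this is the set of Cauchy data. -/
def dnGraph {n : ℕ} (Ω : Set (E n)) (γ : E n → Matrix (Fin n) (Fin n) ℝ) (lam : ℝ) :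
    Set (HHalf Ω × HMinusHalf Ω) :=
  {p | ∃ u : H1 Ω, IsWeakSolution Ω γ lam p.1 u ∧
    ∀ (g : HHalf Ω) (v : H1 Ω), IsTrace Ω v g →
      p.2.1 g = energy Ω γ u v - lam * pairing Ω (fn u) (fn v)}

open Classical in
/-- The Dirichlet-to-Neumann map as a function: `Λ_{γ,λ} f` is the unique element of
`H^{-1/2}(∂Ω)` paired with `f` in the graph (with value `0` where there is no such unique
element). -/
def dnMap {n : ℕ} (Ω : Set (E n)) (γ : E n → Matrix (Fin n) (Fin n) ℝ) (lam : ℝ) (f : HHalf Ω) :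
    HMinusHalf Ω :=
  if h : ∃! l : HMinusHalf Ω, (f, l) ∈ dnGraph Ω γ lam then h.choose else 0

end DNGauge

end

/-! Extended by the identity, `Ψ` becomes a volume-preserving homeomorphism of `ℝⁿ`, and `u ↦ u ∘ Ψ`
is an isomorphism of `H¹(Ω)` that preserves `H¹₀(Ω)`, boundary values and the `L²` pairing. Since
`∇(u ∘ Ψ) = (DΨ)ᵀ (∇u ∘ Ψ)`, a change of variables carries the energy form of `Ψ_*γ` to that of `γ`,
so the two families of Dirichlet problems are equivalent.

The one analytic point is the weak chain rule for a `Ψ` that is merely `C¹`. In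
`∫ (u ∘ Ψ) ∂ₑφ = ∫ u (∂ₑφ ∘ Ψ⁻¹)` the factor `∂ₑφ ∘ Ψ⁻¹` is the weak divergence of the Piola
transform `(DΨ (φ e)) ∘ Ψ⁻¹`, a field that is only continuous, but compactly supported in `Ω`; its
mollifications are admissible test fields for the weak gradient of `u`. -/

noncomputable section

namespace DNGauge

open Filter Topology

theorem integrable_mul_of_hasCompactSupport {X : Type*} [TopologicalSpace X] [MeasurableSpace X]
    [OpensMeasurableSpace X] {ν : Measure X} {u g : X → ℝ} (hu : Integrable u ν)
    (hg : Continuous g) (hc : HasCompactSupport g) : Integrable (fun x => u x * g x) ν := by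
  obtain ⟨C, hC⟩ := hc.exists_bound_of_continuous hg
  exact hu.mul_bdd hg.aestronglyMeasurable (.of_forall hC)

/-! ### Mollification -/

/-- Bump functions at the origin of `V` whose supports shrink to the origin; their normalizations
are the mollifiers. -/
def shrinkingBump (V : Type*) [NormedAddCommGroup V] (k : ℕ) : ContDiffBump (0 : V) where
  rIn := 1 / (k + 1) / 2
  rOut := 1 / (k + 1)
  rIn_pos := by positivity
  rIn_lt_rOut := half_lt_self (by positivity)

theorem eventually_shrinkingBump_rOut_lt (V : Type*) [NormedAddCommGroup V] {δ : ℝ} (hδ : 0 < δ) :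
    ∀ᶠ k in atTop, (shrinkingBump V k).rOut < δ :=
  tendsto_one_div_add_atTop_nhds_zero_nat.eventually (gt_mem_nhds hδ)

section Mollification

variable {V F : Type*} [NormedAddCommGroup V] [NormedSpace ℝ V] [FiniteDimensional ℝ V]
  [MeasurableSpace V] [BorelSpace V] [NormedAddCommGroup F] [NormedSpace ℝ F]
  {μ : Measure V} [μ.IsAddHaarMeasure] {g : V → F}

/-- The `k`-th mollification of `g`, its convolution with the `k`-th normalized shrinking bump. -/
def mollify (μ : Measure V) (k : ℕ) (g : V → F) : V → F :=
  convolution ((shrinkingBump V k).normed μ) g (ContinuousLinearMap.lsmul ℝ ℝ) μ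

theorem contDiff_mollify (hg : LocallyIntegrable g μ) (k : ℕ) : ContDiff ℝ ∞ (mollify μ k g) :=
  (shrinkingBump V k).hasCompactSupport_normed.contDiff_convolution_left _
    (shrinkingBump V k).contDiff_normed hg

theorem hasCompactSupport_mollify (hc : HasCompactSupport g) (k : ℕ) :
    HasCompactSupport (mollify μ k g) :=
  (shrinkingBump V k).hasCompactSupport_normed.convolution _ hc

theorem eventually_tsupport_mollify_subset (hc : HasCompactSupport g) {U : Set V} (hU : IsOpen U)
    (hs : tsupport g ⊆ U) : ∀ᶠ k in atTop, tsupport (mollify μ k g) ⊆ U := by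
  obtain ⟨δ, hδ, hδU⟩ := hc.isCompact.exists_cthickening_subset_open hU hs
  filter_upwards [eventually_shrinkingBump_rOut_lt V hδ] with k hk
  refine (closure_minimal ?_ Metric.isClosed_cthickening).trans hδU
  refine (support_convolution_subset _).trans ?_
  rintro _ ⟨y, hy, z, hz, rfl⟩
  rw [ContDiffBump.support_normed_eq, mem_ball_zero_iff] at hy
  refine Metric.mem_cthickening_of_dist_le _ z _ _ (subset_closure hz) ?_
  simpa [dist_eq_norm] using (hy.trans hk).le

theorem tendstoUniformly_mollify [CompleteSpace F] (hg : Continuous g)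
    (hc : HasCompactSupport g) : TendstoUniformly (fun k => mollify μ k g) g atTop := by
  refine Metric.tendstoUniformly_iff.2 fun ε hε => ?_
  obtain ⟨δ, hδ, hgδ⟩ :=
    Metric.uniformContinuous_iff.1 (hc.uniformContinuous_of_continuous hg) (ε / 2) (half_pos hε)
  filter_upwards [eventually_shrinkingBump_rOut_lt V hδ] with k hk x
  rw [dist_comm]
  exact (ContDiffBump.dist_normed_convolution_le hg.aestronglyMeasurable fun y hy =>
    (hgδ ((Metric.mem_ball.1 hy).trans hk)).le).trans_lt (half_lt_self hε)

theorem fderiv_mollify (hg : ContDiff ℝ 1 g) (hc : HasCompactSupport g) (k : ℕ) :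
    fderiv ℝ (mollify μ k g) = mollify μ k (fderiv ℝ g) := by
  have hL : (ContinuousLinearMap.lsmul ℝ ℝ : ℝ →L[ℝ] F →L[ℝ] F).precompR V =
      ContinuousLinearMap.lsmul ℝ ℝ := by ext; simp
  funext x
  have hd := hc.hasFDerivAt_convolution_right (ContinuousLinearMap.lsmul ℝ ℝ)
    (((shrinkingBump V k).continuous_normed (μ := μ)).locallyIntegrable (μ := μ)) hg x
  rw [hL] at hd
  exact hd.fderiv

theorem fderiv_mollify_apply (hg : LocallyIntegrable g μ) (k : ℕ) (x v : V) :
    fderiv ℝ (mollify μ k g) x v =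
      ∫ t, fderiv ℝ ((shrinkingBump V k).normed μ) (x - t) v • g t ∂μ := by
  set ρ := (shrinkingBump V k).normed μ
  have hρ : ContDiff ℝ 1 ρ := (shrinkingBump V k).contDiff_normed
  have hρc : HasCompactSupport ρ := (shrinkingBump V k).hasCompactSupport_normed
  have hd : fderiv ℝ (mollify μ k g) x = _ :=
    (hρc.hasFDerivAt_convolution_left (ContinuousLinearMap.lsmul ℝ ℝ) hρ hg x).fderiv
  have hi : ConvolutionExistsAt (fderiv ℝ ρ) g x
      ((ContinuousLinearMap.lsmul ℝ ℝ : ℝ →L[ℝ] F →L[ℝ] F).precompL V) μ :=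
    (hρc.fderiv (𝕜 := ℝ)).convolutionExists_left _ (hρ.continuous_fderiv one_ne_zero) hg x
  rw [hd, convolution_eq_swap, ContinuousLinearMap.integral_apply hi.integrable_swap]
  simp

theorem tendsto_integral_mul_mollify {ν : Measure V} {u g : V → ℝ} (hu : Integrable u ν)
    (hg : Continuous g) (hc : HasCompactSupport g) :
    Tendsto (fun k => ∫ x, u x * mollify μ k g x ∂ν) atTop (𝓝 (∫ x, u x * g x ∂ν)) := by
  obtain ⟨C, hC⟩ := hc.exists_bound_of_continuous hg
  have hunif := tendstoUniformly_mollify (μ := μ) hg hc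
  refine tendsto_integral_filter_of_dominated_convergence (fun x => ‖u x‖ * (C + 1)) ?_ ?_
    (hu.norm.mul_const _) (.of_forall fun x => (hunif.tendsto_at x).const_mul _)
  · exact .of_forall fun k => hu.aestronglyMeasurable.mul
      (contDiff_mollify hg.locallyIntegrable k).continuous.aestronglyMeasurable
  · filter_upwards [Metric.tendstoUniformly_iff.1 hunif 1 one_pos] with k hk
    refine .of_forall fun x => ?_
    rw [norm_mul]
    gcongr
    exact (norm_le_norm_add_const_of_dist_le (dist_comm (g x) _ ▸ (hk x).le)).trans (by grw [hC x])

end Mollification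

variable {n : ℕ} {Ω : Set (E n)}

/-! ### Weak divergence -/

theorem IsTestFunction.continuous_fderiv_apply {φ : E n → ℝ} (hφ : IsTestFunction Ω φ) (v : E n) :
    Continuous fun x => fderiv ℝ φ x v :=
  (hφ.smooth.continuous_fderiv (by simp)).clm_apply continuous_const

/-- `div b = a` in the sense of distributions on `ℝⁿ`. -/
def IsWeakDivergence (b : E n → E n) (a : E n → ℝ) : Prop :=
  ∀ η : E n → ℝ, ContDiff ℝ ∞ η → HasCompactSupport η →
    ∫ x, η x * a x = -∫ x, fderiv ℝ η x (b x)

theorem clm_apply_eq_sum (L : E n →L[ℝ] ℝ) (v : E n) :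
    L v = ∑ j, L (EuclideanSpace.single j 1) * v j := by
  conv_lhs => rw [← (EuclideanSpace.basisFun (Fin n) ℝ).sum_repr v]
  simp [mul_comm]

theorem eventually_isTestFunction_mollify (hΩ : IsOpen Ω) {g : E n → ℝ} (hg : Continuous g)
    (hc : HasCompactSupport g) (hs : tsupport g ⊆ Ω) :
    ∀ᶠ k in atTop, IsTestFunction Ω (mollify volume k g) := by
  filter_upwards [eventually_tsupport_mollify_subset (μ := volume) hc hΩ hs] with k hk
  exact ⟨contDiff_mollify hg.locallyIntegrable k, hasCompactSupport_mollify hc k, hk⟩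

theorem IsWeakDivergence.mollify_eq_sum_fderiv {b : E n → E n} {a : E n → ℝ}
    (h : IsWeakDivergence b a) (hb : Continuous b) (k : ℕ) (x : E n) :
    mollify volume k a x =
      ∑ j, fderiv ℝ (mollify volume k fun y => b y j) x (EuclideanSpace.single j 1) := by
  set ρ := (shrinkingBump (E n) k).normed volume
  have hρ : ContDiff ℝ ∞ ρ := (shrinkingBump (E n) k).contDiff_normed
  have hρc : HasCompactSupport fun t => ρ (x - t) :=
    (shrinkingBump (E n) k).hasCompactSupport_normed.comp_homeomorph (Homeomorph.subLeft x)
  have hρ' : ∀ t v, fderiv ℝ (fun t => ρ (x - t)) t v = -fderiv ℝ ρ (x - t) v := fun t v => by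
    have hd : HasFDerivAt (fun t => ρ (x - t)) _ t :=
      (hρ.differentiable (by simp) (x - t)).hasFDerivAt.comp t ((hasFDerivAt_id t).const_sub x)
    simp [hd.fderiv]
  have hρb : ContDiff ℝ ∞ fun t => ρ (x - t) := hρ.comp (contDiff_const.sub contDiff_id)
  have hi : ∀ j, Integrable fun t =>
      fderiv ℝ (fun t => ρ (x - t)) t (EuclideanSpace.single j 1) * b t j := fun j =>
    (((hρb.continuous_fderiv (by simp)).clm_apply continuous_const).mul
      (by fun_prop)).integrable_of_hasCompactSupport (hρc.fderiv_apply (𝕜 := ℝ) _).mul_right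
  calc mollify volume k a x = ∫ t, ρ (x - t) * a t := by rw [mollify, convolution_eq_swap]; rfl
    _ = -∫ t, fderiv ℝ (fun t => ρ (x - t)) t (b t) := h _ hρb hρc
    _ = ∑ j, -∫ t, fderiv ℝ (fun t => ρ (x - t)) t (EuclideanSpace.single j 1) * b t j := by
      simp_rw [clm_apply_eq_sum (fderiv ℝ (fun t => ρ (x - t)) _) (b _)]
      rw [integral_finsetSum _ fun j _ => hi j, Finset.sum_neg_distrib]
    _ = _ := by
      refine Finset.sum_congr rfl fun j _ => ?_
      rw [fderiv_mollify_apply (Continuous.locallyIntegrable (by fun_prop)), ← integral_neg]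
      simp only [hρ', neg_mul, neg_neg, smul_eq_mul, ρ]

/-- Mollifying `b` turns it into an admissible test field, whose divergence is the mollified `a`. -/
theorem IsWeakGradient.integral_mul_weakDivergence (hΩ : IsOpen Ω) {u : E n → ℝ} {G : E n → E n}
    (hw : IsWeakGradient Ω u G) (hu : IntegrableOn u Ω) (hG : IntegrableOn G Ω)
    {b : E n → E n} {a : E n → ℝ} (h : IsWeakDivergence b a)
    (ha : Continuous a) (hac : HasCompactSupport a)
    (hb : Continuous b) (hbc : HasCompactSupport b) (hbs : tsupport b ⊆ Ω) :
    ∫ x in Ω, u x * a x = -∫ x in Ω, inner ℝ (G x) (b x) := by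
  have hbj : ∀ j, Continuous fun x => b x j := fun j => by fun_prop
  have hbcj : ∀ j, HasCompactSupport fun x => b x j := fun j =>
    hbc.comp_left (g := fun v : E n => v j) rfl
  have hbsj : ∀ j, tsupport (fun x => b x j) ⊆ Ω := fun j =>
    (tsupport_comp_subset (g := fun v : E n => v j) rfl b).trans hbs
  have hGj : ∀ j, IntegrableOn (fun x => G x j) Ω := fun j =>
    (EuclideanSpace.proj j : E n →L[ℝ] ℝ).integrable_comp hG
  have hlim : Tendsto (fun k => -∑ j, ∫ x in Ω, G x j * mollify volume k (fun y => b y j) x) atTop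
      (𝓝 (-∑ j, ∫ x in Ω, G x j * b x j)) :=
    (tendsto_finsetSum _ fun j _ =>
      tendsto_integral_mul_mollify (hGj j) (hbj j) (hbcj j)).neg
  have hinner : ∫ x in Ω, inner ℝ (G x) (b x) = ∑ j, ∫ x in Ω, G x j * b x j := by
    rw [← integral_finsetSum]
    · simp [PiLp.inner_apply, mul_comm]
    · exact fun j _ => integrable_mul_of_hasCompactSupport (hGj j) (hbj j) (hbcj j)
  rw [hinner]
  refine tendsto_nhds_unique (tendsto_integral_mul_mollify (μ := volume) hu ha hac) (hlim.congr' ?_)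
  filter_upwards [eventually_all.2 fun j =>
    eventually_isTestFunction_mollify hΩ (hbj j) (hbcj j) (hbsj j)] with k hk
  simp_rw [h.mollify_eq_sum_fderiv hb k, Finset.mul_sum]
  rw [integral_finsetSum, ← Finset.sum_neg_distrib]
  · exact Finset.sum_congr rfl fun j _ => (hw _ (hk j) j).symm
  · exact fun j _ => integrable_mul_of_hasCompactSupport hu
      ((hk j).continuous_fderiv_apply _)
      ((hk j).compact.fderiv_apply (𝕜 := ℝ) _)

/-! ### `C¹` functions as elements of `H¹` -/

theorem gradient_apply (w : E n → ℝ) (x : E n) (i : Fin n) :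
    gradient w x i = fderiv ℝ w x (EuclideanSpace.single i 1) := by
  rw [← InnerProductSpace.toDual_symm_apply (𝕜 := ℝ) (x := EuclideanSpace.single i 1)
    (y := fderiv ℝ w x), EuclideanSpace.inner_single_right]
  simp [gradient]

theorem IsWeakGradient.congr_ae {u v : E n → ℝ} {G H : E n → E n} (h : IsWeakGradient Ω u G)
    (hu : u =ᵐ[volume.restrict Ω] v) (hG : G =ᵐ[volume.restrict Ω] H) :
    IsWeakGradient Ω v H := by
  intro φ hφ i
  refine (integral_congr_ae ?_).trans ((h φ hφ i).trans (congrArg Neg.neg (integral_congr_ae ?_)))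
  · filter_upwards [hu] with x hx
    rw [hx]
  · filter_upwards [hG] with x hx
    rw [hx]

theorem setIntegral_eq_integral_of_tsupport_subset {X F : Type*} [TopologicalSpace X]
    [MeasurableSpace X] {μ : Measure X} [NormedAddCommGroup F] [NormedSpace ℝ F] {s : Set X}
    {f : X → F} (h : tsupport f ⊆ s) : ∫ x in s, f x ∂μ = ∫ x, f x ∂μ :=
  setIntegral_eq_integral_of_forall_compl_eq_zero fun _ hx =>
    image_eq_zero_of_notMem_tsupport fun hx' => hx (h hx')

theorem integrable_mul_of_tsupport_subset (hΩ : IsOpen Ω) {f g : E n → ℝ} (hf : ContinuousOn f Ω)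
    (hg : Continuous g) (hc : HasCompactSupport g) (hs : tsupport g ⊆ Ω) :
    Integrable fun x => f x * g x :=
  ((hf.mul hg.continuousOn).continuous_of_tsupport_subset hΩ
    ((tsupport_mul_subset_right (f := f)).trans hs)).integrable_of_hasCompactSupport hc.mul_left

theorem IsTestFunction.tsupport_fderiv_apply {φ : E n → ℝ} (hφ : IsTestFunction Ω φ) (v : E n) :
    tsupport (fun x => fderiv ℝ φ x v) ⊆ Ω :=
  (tsupport_fderiv_apply_subset ℝ v).trans hφ.support

theorem IsTestFunction.integral_mul_fderiv (hΩ : IsOpen Ω) {φ : E n → ℝ} (hφ : IsTestFunction Ω φ)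
    {w : E n → ℝ} (hw : ContDiffOn ℝ 1 w Ω) (v : E n) :
    ∫ x, w x * fderiv ℝ φ x v = -∫ x, fderiv ℝ w x v * φ x :=
  integral_mul_fderiv_eq_neg_fderiv_mul_of_integrable
    (integrable_mul_of_tsupport_subset hΩ
      ((hw.continuousOn_fderiv_of_isOpen hΩ le_rfl).clm_apply continuousOn_const)
      hφ.smooth.continuous hφ.compact hφ.support)
    (integrable_mul_of_tsupport_subset hΩ hw.continuousOn (hφ.continuous_fderiv_apply v)
      (hφ.compact.fderiv_apply (𝕜 := ℝ) v) (hφ.tsupport_fderiv_apply v))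
    (integrable_mul_of_tsupport_subset hΩ hw.continuousOn hφ.smooth.continuous hφ.compact
      hφ.support)
    (fun _ hx => (hw.differentiableOn one_ne_zero).differentiableAt
      (hΩ.mem_nhds (hφ.support hx)))
    fun x _ => hφ.smooth.differentiable (by simp) x

theorem isWeakGradient_gradient (hΩ : IsOpen Ω) {w : E n → ℝ} (hw : ContDiffOn ℝ 1 w Ω) :
    IsWeakGradient Ω w (gradient w) := by
  intro φ hφ i
  simp_rw [gradient_apply]
  rw [setIntegral_eq_integral_of_tsupport_subset
      (tsupport_mul_subset_right.trans (hφ.tsupport_fderiv_apply _)),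
    setIntegral_eq_integral_of_tsupport_subset (tsupport_mul_subset_right.trans hφ.support)]
  exact hφ.integral_mul_fderiv hΩ hw _

theorem exists_represents (hΩ : IsOpen Ω) {w : E n → ℝ} (hw : ContDiff ℝ 1 w)
    (hc : HasCompactSupport w) : ∃ u : H1 Ω, Represents w u := by
  let ι := (InnerProductSpace.toDual ℝ (E n)).symm
  have hw2 : MemLp w 2 (volume.restrict Ω) :=
    (hw.continuous.memLp_of_hasCompactSupport hc).restrict Ω
  have hg2 : MemLp (gradient w) 2 (volume.restrict Ω) :=
    ((ι.continuous.comp (hw.continuous_fderiv one_ne_zero)).memLp_of_hasCompactSupport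
      ((hc.fderiv (𝕜 := ℝ)).comp_left (map_zero ι))).restrict Ω
  refine ⟨⟨(hw2.toLp w, hg2.toLp _), (isWeakGradient_gradient hΩ hw.contDiffOn).congr_ae
    hw2.coeFn_toLp.symm hg2.coeFn_toLp.symm⟩, hw2.coeFn_toLp, ?_⟩
  filter_upwards [hg2.coeFn_toLp] with x hx
  exact hx ▸ (hw.differentiable one_ne_zero x).hasGradientAt

theorem norm_sub_le_of_represents [IsFiniteMeasure ((volume : Measure (E n)).restrict Ω)]
    {φ ψ : E n → ℝ} {u v : H1 Ω} (hu : Represents φ u) (hv : Represents ψ v) {δ : ℝ} (hδ : 0 ≤ δ)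
    (h : ∀ x, dist (φ x) (ψ x) ≤ δ) (h' : ∀ x, dist (fderiv ℝ φ x) (fderiv ℝ ψ x) ≤ δ) :
    ‖u - v‖ ≤ (measureUnivNNReal (volume.restrict Ω)) ^ (2 : ENNReal).toReal⁻¹ * δ := by
  refine max_le (Lp.norm_le_of_ae_bound hδ ?_) (Lp.norm_le_of_ae_bound hδ ?_)
  · filter_upwards [hu.1, hv.1, Lp.coeFn_sub (fn u) (fn v)] with x h1 h2 h3
    refine (congrArg norm h3).trans_le ?_
    rw [Pi.sub_apply, h1, h2]
    exact h x
  · filter_upwards [hu.2, hv.2, Lp.coeFn_sub (grad u) (grad v)] with x h1 h2 h3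
    refine (congrArg norm h3).trans_le ?_
    rw [Pi.sub_apply, ← (InnerProductSpace.toDual ℝ (E n)).norm_map, map_sub,
      ← h1.hasFDerivAt.fderiv, ← h2.hasFDerivAt.fderiv, ← dist_eq_norm]
    exact h' x

theorem mem_H10_of_represents (hΩ : IsOpen Ω)
    [IsFiniteMeasure ((volume : Measure (E n)).restrict Ω)] {w : E n → ℝ} (hw : ContDiff ℝ 1 w)
    (hc : HasCompactSupport w) (hs : tsupport w ⊆ Ω) {v : H1 Ω} (hv : Represents w v) :
    v ∈ H10 Ω := by
  refine Metric.mem_closure_iff.2 fun ε hε => ?_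
  obtain ⟨δ, hδ, hδε⟩ := exists_pos_mul_lt hε
    ((measureUnivNNReal ((volume : Measure (E n)).restrict Ω) : ℝ) ^ (2 : ENNReal).toReal⁻¹)
  have hw0 := Metric.tendstoUniformly_iff.1
    (tendstoUniformly_mollify (μ := volume) hw.continuous hc) δ hδ
  have hw1 := Metric.tendstoUniformly_iff.1 (tendstoUniformly_mollify (μ := volume)
    (hw.continuous_fderiv one_ne_zero) (hc.fderiv (𝕜 := ℝ))) δ hδ
  obtain ⟨k, hk, hk0, hk1⟩ :=
    ((eventually_isTestFunction_mollify hΩ hw.continuous hc hs).and (hw0.and hw1)).exists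
  obtain ⟨u, hu⟩ := exists_represents hΩ (hk.smooth.of_le (by simp)) hk.compact
  refine ⟨u, ⟨_, hk, hu⟩, (dist_eq_norm v u).trans_lt (lt_of_le_of_lt ?_ hδε)⟩
  refine norm_sub_le_of_represents hv hu hδ.le (fun x => (hk0 x).le) fun x => ?_
  rw [fderiv_mollify hw hc]
  exact (hk1 x).le

/-! ### Volume-preserving homeomorphisms fixing the complement of `Ω` -/

/-- A homeomorphism of `ℝⁿ` that is the identity off the bounded open set `Ω` and restricts to a
volume-preserving `C¹` diffeomorphism of `Ω̄`; the elements of `SDiff(Ω̄)` are handled through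
their extensions by the identity, which are total and so have honest inverses. -/
structure IsGauge (Ω : Set (E n)) (Ψ : E n ≃ₜ E n) : Prop where
  isOpen : IsOpen Ω
  isBounded : Bornology.IsBounded Ω
  eq_self : ∀ x ∉ Ω, Ψ x = x
  contDiffOn : ContDiffOn ℝ 1 Ψ (closure Ω)
  contDiffOn_symm : ContDiffOn ℝ 1 Ψ.symm (closure Ω)
  abs_det : ∀ x ∈ Ω, |(fderiv ℝ Ψ x).det| = 1

/-- Up to the boundary only one-sided `C¹` regularity is available, so the bound is obtained locally
on `closure Ω` from the continuous derivatives within it, and patched by compactness. -/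
theorem exists_bound_fderiv_of_contDiffOn_closure {V F : Type*} [NormedAddCommGroup V]
    [NormedSpace ℝ V] [NormedAddCommGroup F] [NormedSpace ℝ F] {s : Set V} (hs : IsOpen s)
    (hc : IsCompact (closure s)) {f : V → F} (hf : ContDiffOn ℝ 1 f (closure s)) :
    ∃ C : ℝ, ∀ x ∈ s, ‖fderiv ℝ f x‖ ≤ C := by
  have hloc : ∀ x ∈ closure s, ∃ t ∈ 𝓝[closure s] x,
      ∃ C : ℝ, ∀ y ∈ t ∩ s, ‖fderiv ℝ f y‖ ≤ C := by
    intro x hx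
    obtain ⟨u, hu, -, f', hf', hf'c⟩ :=
      (contDiffWithinAt_succ_iff_hasFDerivWithinAt (n := 0) (by simp)).1 (by simpa using hf x hx)
    rw [insert_eq_of_mem hx] at hu
    have hlt : ∀ᶠ y in 𝓝[closure s] x, ‖f' y‖ < ‖f' x‖ + 1 :=
      nhdsWithin_le_of_mem hu (hf'c.continuousWithinAt.norm.eventually (gt_mem_nhds (lt_add_one _)))
    refine ⟨{y | u ∈ 𝓝[closure s] y ∧ ‖f' y‖ < ‖f' x‖ + 1},
      (eventually_eventually_nhdsWithin.2 hu).and hlt, ‖f' x‖ + 1, fun y ⟨⟨hyu, hy⟩, hys⟩ => ?_⟩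
    rw [nhdsWithin_eq_nhds.2 (mem_of_superset (hs.mem_nhds hys) subset_closure)] at hyu
    rw [((hf' y (mem_of_mem_nhds hyu)).hasFDerivAt hyu).fderiv]
    exact hy.le
  obtain ⟨C, hC⟩ := hc.induction_on
    (p := fun t => ∃ C : ℝ, ∀ y ∈ t ∩ s, ‖fderiv ℝ f y‖ ≤ C) ⟨0, by simp⟩
    (fun t t' htt' ⟨C, hC⟩ => ⟨C, fun y hy => hC y ⟨htt' hy.1, hy.2⟩⟩)
    (fun t t' ⟨C, hC⟩ ⟨D, hD⟩ => ⟨max C D, fun y hy => hy.1.elim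
      (fun h => (hC y ⟨h, hy.2⟩).trans (le_max_left _ _))
      (fun h => (hD y ⟨h, hy.2⟩).trans (le_max_right _ _))⟩) hloc
  exact ⟨C, fun x hx => hC x ⟨subset_closure hx, hx⟩⟩

namespace IsGauge

variable {Ψ : E n ≃ₜ E n}

theorem isFiniteMeasure (h : IsGauge Ω Ψ) : IsFiniteMeasure ((volume : Measure (E n)).restrict Ω) :=
  isFiniteMeasure_restrict.2 h.isBounded.measure_lt_top.ne

theorem apply_mem_iff (h : IsGauge Ω Ψ) {x : E n} : Ψ x ∈ Ω ↔ x ∈ Ω := by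
  by_cases hx : x ∈ Ω
  · refine iff_of_true (by_contra fun hc => hc ?_) hx
    rwa [Ψ.injective (h.eq_self _ hc)]
  · rw [h.eq_self x hx]

theorem symm_apply_mem_iff (h : IsGauge Ω Ψ) {x : E n} : Ψ.symm x ∈ Ω ↔ x ∈ Ω := by
  rw [← h.apply_mem_iff, Homeomorph.apply_symm_apply]

theorem contDiffAt (h : IsGauge Ω Ψ) {x : E n} (hx : x ∈ Ω) : ContDiffAt ℝ 1 Ψ x :=
  h.contDiffOn.contDiffAt (mem_of_superset (h.isOpen.mem_nhds hx) subset_closure)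

theorem differentiableAt (h : IsGauge Ω Ψ) {x : E n} (hx : x ∈ Ω) : DifferentiableAt ℝ Ψ x :=
  (h.contDiffAt hx).differentiableAt one_ne_zero

theorem fderiv_comp_fderiv_symm (h : IsGauge Ω Ψ) {x : E n} (hx : x ∈ Ω) :
    fderiv ℝ Ψ (Ψ.symm x) ∘L fderiv ℝ Ψ.symm x = ContinuousLinearMap.id ℝ (E n) := by
  have hsymm : DifferentiableAt ℝ Ψ.symm x := (h.contDiffOn_symm.contDiffAt
    (mem_of_superset (h.isOpen.mem_nhds hx) subset_closure)).differentiableAt one_ne_zero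
  rw [← fderiv_comp x (h.differentiableAt (h.symm_apply_mem_iff.2 hx)) hsymm,
    Ψ.self_comp_symm, fderiv_id]

protected theorem symm (h : IsGauge Ω Ψ) : IsGauge Ω Ψ.symm where
  isOpen := h.isOpen
  isBounded := h.isBounded
  eq_self x hx := by rw [Homeomorph.symm_apply_eq, h.eq_self x hx]
  contDiffOn := h.contDiffOn_symm
  contDiffOn_symm := h.contDiffOn
  abs_det x hx := by
    have hdet : (fderiv ℝ Ψ (Ψ.symm x)).det * (fderiv ℝ Ψ.symm x).det = 1 := by
      simpa [ContinuousLinearMap.det, LinearMap.det_comp] using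
        congrArg ContinuousLinearMap.det (h.fderiv_comp_fderiv_symm hx)
    simpa [abs_mul, h.abs_det _ (h.symm_apply_mem_iff.2 hx)] using congrArg abs hdet

theorem measurePreserving_restrict (h : IsGauge Ω Ψ) :
    MeasurePreserving Ψ (volume.restrict Ω) (volume.restrict Ω) := by
  refine ⟨Ψ.measurable, ?_⟩
  have hone : (fun x => ENNReal.ofReal |(fderiv ℝ Ψ x).det|) =ᵐ[volume.restrict Ω] 1 := by
    filter_upwards [ae_restrict_mem h.isOpen.measurableSet] with x hx
    simp [h.abs_det x hx]
  have himage : Ψ '' Ω = Ω := by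
    ext x
    rw [Ψ.image_eq_preimage_symm, mem_preimage, h.symm_apply_mem_iff]
  have hmap := map_withDensity_abs_det_fderiv_eq_addHaar volume
    h.isOpen.measurableSet.nullMeasurableSet
    (fun x hx => (h.differentiableAt hx).hasFDerivAt.hasFDerivWithinAt) Ψ.injective.injOn
  rwa [himage, withDensity_congr_ae hone, withDensity_one] at hmap

theorem measurePreserving (h : IsGauge Ω Ψ) : MeasurePreserving Ψ volume volume := by
  refine ⟨Ψ.measurable, ?_⟩
  have hcompl : (volume.restrict Ωᶜ).map Ψ = volume.restrict Ωᶜ := by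
    have hid : Ψ =ᵐ[volume.restrict Ωᶜ] id := by
      filter_upwards [ae_restrict_mem h.isOpen.measurableSet.compl] with x hx using h.eq_self x hx
    rw [Measure.map_congr hid, Measure.map_id]
  rw [← Measure.restrict_add_restrict_compl (μ := volume) h.isOpen.measurableSet,
    Measure.map_add _ _ Ψ.measurable, h.measurePreserving_restrict.map_eq, hcompl]

theorem integral_comp (h : IsGauge Ω Ψ) (f : E n → ℝ) : ∫ x, f (Ψ x) = ∫ x, f x :=
  h.measurePreserving.integral_comp Ψ.measurableEmbedding f

theorem setIntegral_comp (h : IsGauge Ω Ψ) (f : E n → ℝ) : ∫ x in Ω, f (Ψ x) = ∫ x in Ω, f x :=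
  h.measurePreserving_restrict.integral_comp Ψ.measurableEmbedding f

theorem ae_comp (h : IsGauge Ω Ψ) {p : E n → Prop} (hp : ∀ᵐ x ∂volume.restrict Ω, p x) :
    ∀ᵐ x ∂volume.restrict Ω, p (Ψ x) :=
  h.measurePreserving_restrict.quasiMeasurePreserving.ae hp

/-! ### The weak chain rule -/

end IsGauge

theorem support_fderiv_apply_subset {V F : Type*} [NormedAddCommGroup V] [NormedSpace ℝ V]
    [NormedAddCommGroup F] [NormedSpace ℝ F] (f : V → F) (b : V → V) :
    (Function.support fun x => fderiv ℝ f x (b x)) ⊆ Function.support b :=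
  fun x hx hbx => hx (by simp [hbx])

/-- The Piola transform `(DΨ b) ∘ Ψ⁻¹` of the vector field `b` under a volume-preserving `Ψ`. -/
def piolaTransform (Ψ : E n ≃ₜ E n) (b : E n → E n) : E n → E n := fun y =>
  fderiv ℝ Ψ (Ψ.symm y) (b (Ψ.symm y))

namespace IsGauge

variable {Ψ : E n ≃ₜ E n}

theorem tsupport_comp_symm_subset (h : IsGauge Ω Ψ) {F : Type*} [Zero F] {f : E n → F}
    (hf : tsupport f ⊆ Ω) : tsupport (f ∘ Ψ.symm) ⊆ Ω := by
  rw [tsupport_comp_eq_preimage f Ψ.symm]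
  exact fun x hx => h.symm_apply_mem_iff.1 (hf hx)

theorem continuous_piolaTransform (h : IsGauge Ω Ψ) {b : E n → E n} (hb : Continuous b)
    (hs : tsupport b ⊆ Ω) : Continuous (piolaTransform Ψ b) := by
  have hcont : ContinuousOn (fun x => fderiv ℝ Ψ x (b x)) Ω :=
    ((h.contDiffOn.mono subset_closure).continuousOn_fderiv_of_isOpen h.isOpen le_rfl).clm_apply
      hb.continuousOn
  exact (hcont.continuous_of_tsupport_subset h.isOpen
    ((closure_mono (support_fderiv_apply_subset Ψ b)).trans hs)).comp Ψ.symm.continuous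

theorem hasCompactSupport_piolaTransform (Ψ : E n ≃ₜ E n) {b : E n → E n}
    (hc : HasCompactSupport b) : HasCompactSupport (piolaTransform Ψ b) :=
  (hc.mono (support_fderiv_apply_subset Ψ b)).comp_homeomorph Ψ.symm

theorem tsupport_piolaTransform_subset (h : IsGauge Ω Ψ) {b : E n → E n} (hs : tsupport b ⊆ Ω) :
    tsupport (piolaTransform Ψ b) ⊆ Ω :=
  h.tsupport_comp_symm_subset (f := fun x => fderiv ℝ Ψ x (b x))
    ((closure_mono (support_fderiv_apply_subset Ψ b)).trans hs)

/-- The Piola identity. Second derivatives of `Ψ` need not exist, so it is proved weakly, by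
changing variables and integrating `η ∘ Ψ` by parts. -/
theorem isWeakDivergence_piolaTransform (h : IsGauge Ω Ψ) {φ : E n → ℝ} (hφ : IsTestFunction Ω φ)
    (e : E n) : IsWeakDivergence (piolaTransform Ψ fun x => φ x • e)
      fun y => fderiv ℝ φ (Ψ.symm y) e := by
  intro η hη _
  have hcomp : ContDiffOn ℝ 1 (η ∘ Ψ) Ω :=
    (hη.of_le (by simp)).comp_contDiffOn (h.contDiffOn.mono subset_closure)
  have hchain : ∀ x, fderiv ℝ η (Ψ x) (fderiv ℝ Ψ x (φ x • e)) = fderiv ℝ (η ∘ Ψ) x e * φ x := by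
    intro x
    by_cases hx : x ∈ Ω
    · rw [fderiv_comp x (hη.differentiable (by simp) _) (h.differentiableAt hx)]
      simp [mul_comm]
    · simp [image_eq_zero_of_notMem_tsupport fun hx' => hx (hφ.support hx')]
  calc ∫ y, η y * fderiv ℝ φ (Ψ.symm y) e
      = ∫ x, (η ∘ Ψ) x * fderiv ℝ φ x e := by
          rw [← h.integral_comp fun y => η y * fderiv ℝ φ (Ψ.symm y) e]
          simp
    _ = -∫ x, fderiv ℝ (η ∘ Ψ) x e * φ x := hφ.integral_mul_fderiv h.isOpen hcomp e
    _ = -∫ y, fderiv ℝ η y (piolaTransform Ψ (fun x => φ x • e) y) := by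
      rw [← h.integral_comp fun y => fderiv ℝ η y _]
      simp only [piolaTransform, Homeomorph.symm_apply_apply, hchain]

theorem isWeakGradient_comp (h : IsGauge Ω Ψ) {u : E n → ℝ} {G : E n → E n}
    (hw : IsWeakGradient Ω u G) (hu : IntegrableOn u Ω) (hG : IntegrableOn G Ω) :
    IsWeakGradient Ω (fun x => u (Ψ x))
      fun x => ContinuousLinearMap.adjoint (fderiv ℝ Ψ x) (G (Ψ x)) := by
  intro φ hφ i
  set e : E n := EuclideanSpace.single i 1
  have hb : Continuous fun x => φ x • e := hφ.smooth.continuous.smul continuous_const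
  have hbs : tsupport (fun x => φ x • e) ⊆ Ω := (tsupport_smul_subset_left φ _).trans hφ.support
  have hbc : HasCompactSupport fun x => φ x • e := hφ.compact.smul_right
  have hcoord : ∀ x, inner ℝ (G (Ψ x)) (fderiv ℝ Ψ x (φ x • e)) =
      ContinuousLinearMap.adjoint (fderiv ℝ Ψ x) (G (Ψ x)) i * φ x := fun x => by
    rw [← ContinuousLinearMap.adjoint_inner_left, inner_smul_right,
      EuclideanSpace.inner_single_right]
    simp [mul_comm]
  calc ∫ x in Ω, u (Ψ x) * fderiv ℝ φ x e
      = ∫ y in Ω, u y * fderiv ℝ φ (Ψ.symm y) e := by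
          rw [← h.setIntegral_comp fun y => u y * fderiv ℝ φ (Ψ.symm y) e]
          simp
    _ = -∫ y in Ω, inner ℝ (G y) (piolaTransform Ψ (fun x => φ x • e) y) :=
      hw.integral_mul_weakDivergence h.isOpen hu hG (h.isWeakDivergence_piolaTransform hφ e)
        ((hφ.continuous_fderiv_apply e).comp Ψ.symm.continuous)
        ((hφ.compact.fderiv_apply (𝕜 := ℝ) e).comp_homeomorph Ψ.symm)
        (h.continuous_piolaTransform hb hbs) (hasCompactSupport_piolaTransform Ψ hbc)
        (h.tsupport_piolaTransform_subset hbs)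
    _ = -∫ x in Ω, ContinuousLinearMap.adjoint (fderiv ℝ Ψ x) (G (Ψ x)) i * φ x := by
      rw [← h.setIntegral_comp]
      simp only [piolaTransform, Homeomorph.symm_apply_apply, hcoord]

/-! ### The pullback operator on `H¹` -/

theorem memLp_adjoint_fderiv (h : IsGauge Ω Ψ) :
    MemLp (fun x => ContinuousLinearMap.adjoint (fderiv ℝ Ψ x)) ⊤ (volume.restrict Ω) := by
  obtain ⟨C, hC⟩ := exists_bound_fderiv_of_contDiffOn_closure h.isOpen
    h.isBounded.isCompact_closure h.contDiffOn
  refine memLp_top_of_bound (ContinuousLinearMap.adjoint.continuous.comp_aestronglyMeasurable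
    (measurable_fderiv ℝ Ψ).aestronglyMeasurable) C ?_
  filter_upwards [ae_restrict_mem h.isOpen.measurableSet] with x hx
  rw [LinearIsometryEquiv.norm_map]
  exact hC x hx

/-- Pullback of functions, `u ↦ u ∘ Ψ`, on `L²(Ω)`. -/
def fnPullback (h : IsGauge Ω Ψ) : L2 Ω ℝ →L[ℝ] L2 Ω ℝ :=
  (Lp.compMeasurePreservingₗᵢ ℝ Ψ h.measurePreserving_restrict).toContinuousLinearMap

/-- Pullback of gradients, `g ↦ (DΨ)ᵀ (g ∘ Ψ)`, on `L²(Ω; ℝⁿ)`. -/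
def gradPullback (h : IsGauge Ω Ψ) : L2 Ω (E n) →L[ℝ] L2 Ω (E n) :=
  (ContinuousLinearMap.id ℝ (E n →L[ℝ] E n)).holderL (volume.restrict Ω) ⊤ 2 2
      (h.memLp_adjoint_fderiv.toLp _) ∘L
    (Lp.compMeasurePreservingₗᵢ ℝ Ψ h.measurePreserving_restrict).toContinuousLinearMap

theorem coeFn_fnPullback (h : IsGauge Ω Ψ) (u : L2 Ω ℝ) :
    h.fnPullback u =ᵐ[volume.restrict Ω] fun x => u (Ψ x) :=
  Lp.coeFn_compMeasurePreserving u h.measurePreserving_restrict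

theorem coeFn_gradPullback (h : IsGauge Ω Ψ) (g : L2 Ω (E n)) :
    h.gradPullback g =ᵐ[volume.restrict Ω]
      fun x => ContinuousLinearMap.adjoint (fderiv ℝ Ψ x) (g (Ψ x)) := by
  filter_upwards [(ContinuousLinearMap.id ℝ (E n →L[ℝ] E n)).coeFn_holder (r := 2)
      (h.memLp_adjoint_fderiv.toLp _) (Lp.compMeasurePreserving Ψ h.measurePreserving_restrict g),
    h.memLp_adjoint_fderiv.coeFn_toLp,
    Lp.coeFn_compMeasurePreserving g h.measurePreserving_restrict] with x hholder hadj hcomp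
  refine hholder.trans ?_
  rw [hadj, hcomp]
  rfl

theorem prodMap_pullback_mem_H1 (h : IsGauge Ω Ψ) (u : H1 Ω) :
    (h.fnPullback.prodMap h.gradPullback) u ∈ H1 Ω := by
  have := h.isFiniteMeasure
  exact (h.isWeakGradient_comp u.2 ((Lp.memLp (fn u)).integrable (by norm_num))
    ((Lp.memLp (grad u)).integrable (by norm_num))).congr_ae
      (h.coeFn_fnPullback (fn u)).symm (h.coeFn_gradPullback (grad u)).symm

/-- The pullback `u ↦ u ∘ Ψ` on `H¹(Ω)`. -/
def pullback (h : IsGauge Ω Ψ) : H1 Ω →L[ℝ] H1 Ω :=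
  (h.fnPullback.prodMap h.gradPullback ∘L (H1 Ω).subtypeL).codRestrict (H1 Ω)
    h.prodMap_pullback_mem_H1

theorem coeFn_fn_pullback (h : IsGauge Ω Ψ) (u : H1 Ω) :
    fn (h.pullback u) =ᵐ[volume.restrict Ω] fun x => fn u (Ψ x) :=
  h.coeFn_fnPullback (fn u)

theorem coeFn_grad_pullback (h : IsGauge Ω Ψ) (u : H1 Ω) :
    grad (h.pullback u) =ᵐ[volume.restrict Ω]
      fun x => ContinuousLinearMap.adjoint (fderiv ℝ Ψ x) (grad u (Ψ x)) :=
  h.coeFn_gradPullback (grad u)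

theorem fnPullback_symm_fnPullback (h : IsGauge Ω Ψ) (u : L2 Ω ℝ) :
    h.symm.fnPullback (h.fnPullback u) = u := by
  refine Lp.ext ?_
  filter_upwards [h.symm.coeFn_fnPullback (h.fnPullback u),
    h.symm.ae_comp (h.coeFn_fnPullback u)] with x h1 h2
  rw [h1, h2, Homeomorph.apply_symm_apply]

theorem pullback_symm_pullback (h : IsGauge Ω Ψ) (u : H1 Ω) :
    h.symm.pullback (h.pullback u) = u := by
  refine Subtype.ext (Prod.ext (h.fnPullback_symm_fnPullback (fn u)) (Lp.ext ?_))
  filter_upwards [h.symm.coeFn_grad_pullback (h.pullback u),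
    h.symm.ae_comp (h.coeFn_grad_pullback u),
    ae_restrict_mem h.isOpen.measurableSet] with x h1 h2 hx
  refine h1.trans ?_
  rw [h2, ← ContinuousLinearMap.comp_apply, ← ContinuousLinearMap.adjoint_comp,
    h.fderiv_comp_fderiv_symm hx, Homeomorph.apply_symm_apply, ContinuousLinearMap.adjoint_id]
  rfl

theorem represents_pullback (h : IsGauge Ω Ψ) {φ : E n → ℝ} {u : H1 Ω} (hu : Represents φ u) :
    Represents (φ ∘ Ψ) (h.pullback u) := by
  constructor
  · filter_upwards [h.coeFn_fn_pullback u, h.ae_comp hu.1] with x h1 h2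
    rw [h1, h2, Function.comp_apply]
  · filter_upwards [h.coeFn_grad_pullback u, h.ae_comp hu.2,
      ae_restrict_mem h.isOpen.measurableSet] with x h1 h2 hx
    rw [hasGradientAt_iff_hasFDerivAt, h1]
    have hdual : InnerProductSpace.toDual ℝ (E n)
        (ContinuousLinearMap.adjoint (fderiv ℝ Ψ x) (grad u (Ψ x))) =
          InnerProductSpace.toDual ℝ (E n) (grad u (Ψ x)) ∘L fderiv ℝ Ψ x := by
      ext1 v
      simp [ContinuousLinearMap.adjoint_inner_left]
    rw [hdual]
    exact h2.hasFDerivAt.comp x (h.differentiableAt hx).hasFDerivAt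

theorem contDiff_comp (h : IsGauge Ω Ψ) {φ : E n → ℝ} (hφ : IsTestFunction Ω φ) :
    ContDiff ℝ 1 (φ ∘ Ψ) := by
  refine contDiff_iff_contDiffAt.2 fun x => ?_
  by_cases hx : x ∈ tsupport (φ ∘ Ψ)
  swap
  · exact contDiffAt_const.congr_of_eventuallyEq (notMem_tsupport_iff_eventuallyEq.1 hx)
  rw [tsupport_comp_eq_preimage] at hx
  exact (hφ.smooth.of_le (by simp)).contDiffAt.comp x
    (h.contDiffAt (h.apply_mem_iff.1 (hφ.support hx)))

theorem pullback_mem_H10 (h : IsGauge Ω Ψ) {u : H1 Ω} (hu : u ∈ H10 Ω) :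
    h.pullback u ∈ H10 Ω := by
  have := h.isFiniteMeasure
  have hclosed : IsClosed (H10 Ω : Set (H1 Ω)) := Submodule.isClosed_topologicalClosure _
  refine closure_minimal ?_ (hclosed.preimage h.pullback.continuous) hu
  rintro v ⟨φ, hφ, hv⟩
  exact mem_H10_of_represents h.isOpen (h.contDiff_comp hφ) (hφ.compact.comp_homeomorph Ψ)
    (h.symm.tsupport_comp_symm_subset hφ.support) (h.represents_pullback hv)

theorem isTrace_pullback (h : IsGauge Ω Ψ) {u : H1 Ω} {f : L2Boundary Ω} (hu : IsTrace Ω u f) :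
    IsTrace Ω (h.pullback u) f := by
  have hclosed : IsClosed (traceGraph Ω : Set (H1 Ω × L2Boundary Ω)) :=
    Submodule.isClosed_topologicalClosure _
  have hmaps : MapsTo Ψ (closure Ω) (closure Ω) :=
    MapsTo.closure (fun _ hx => h.apply_mem_iff.2 hx) Ψ.continuous
  refine closure_minimal (t := Prod.map h.pullback id ⁻¹' traceGraph Ω) ?_
    (hclosed.preimage (h.pullback.continuous.prodMap continuous_id)) hu
  rintro ⟨v, g⟩ ⟨φ, hφ, hv, hg⟩
  refine subset_closure ⟨_, hφ.comp h.contDiffOn hmaps, h.represents_pullback hv, ?_⟩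
  filter_upwards [hg, ae_restrict_mem isClosed_frontier.measurableSet] with x hgx hx
  rw [h.isOpen.frontier_eq] at hx
  simpa [h.eq_self x hx.2] using hgx

theorem pairing_fnPullback (h : IsGauge Ω Ψ) (u v : L2 Ω ℝ) :
    pairing Ω (h.fnPullback u) (h.fnPullback v) = pairing Ω u v := by
  rw [pairing, pairing, ← h.setIntegral_comp fun x => u x * v x]
  refine integral_congr_ae ?_
  filter_upwards [h.coeFn_fnPullback u, h.coeFn_fnPullback v] with x hu hv
  rw [hu, hv]

end IsGauge

theorem jacobian_of_mem (hΩ : IsOpen Ω) (f : E n → E n) {x : E n} (hx : x ∈ Ω) :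
    jacobian Ω f x = LinearMap.toMatrix (EuclideanSpace.basisFun (Fin n) ℝ).toBasis
      (EuclideanSpace.basisFun (Fin n) ℝ).toBasis (fderiv ℝ f x).toLinearMap := by
  rw [jacobian, fderivWithin_of_mem_nhds (mem_of_superset (hΩ.mem_nhds hx) subset_closure)]

theorem ofLp_adjoint_fderiv (hΩ : IsOpen Ω) (f : E n → E n) {x : E n} (hx : x ∈ Ω) (g : E n) :
    (ContinuousLinearMap.adjoint (fderiv ℝ f x) g).ofLp =
      (jacobian Ω f x).transpose.mulVec g.ofLp := by
  ext i
  have hcoord : ContinuousLinearMap.adjoint (fderiv ℝ f x) g i =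
      inner ℝ (fderiv ℝ f x (EuclideanSpace.single i 1)) g := by
    rw [← ContinuousLinearMap.adjoint_inner_right, EuclideanSpace.inner_single_left]
    simp
  rw [hcoord, jacobian_of_mem hΩ f hx]
  simp [Matrix.mulVec, dotProduct, LinearMap.toMatrix_apply, PiLp.inner_apply, mul_comm]

theorem IsGauge.energy_pullback {Ψ : E n ≃ₜ E n} (h : IsGauge Ω Ψ)
    {β γ : E n → Matrix (Fin n) (Fin n) ℝ}
    (hβ : ∀ x ∈ Ω, β (Ψ x) = jacobian Ω Ψ x * γ x * (jacobian Ω Ψ x).transpose) (u v : H1 Ω) :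
    energy Ω γ (h.pullback u) (h.pullback v) = energy Ω β u v := by
  rw [energy, energy, ← h.setIntegral_comp
    fun x => dotProduct ((β x).mulVec (grad u x).ofLp) (grad v x).ofLp]
  refine integral_congr_ae ?_
  filter_upwards [h.coeFn_grad_pullback u, h.coeFn_grad_pullback v,
    ae_restrict_mem h.isOpen.measurableSet] with x hu hv hx
  rw [hu, hv, hβ x hx, ofLp_adjoint_fderiv h.isOpen Ψ hx, ofLp_adjoint_fderiv h.isOpen Ψ hx,
    Matrix.mulVec_transpose (jacobian Ω Ψ x) (grad v (Ψ x)).ofLp,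
    dotProduct_comm, ← Matrix.dotProduct_mulVec, dotProduct_comm]
  simp only [Matrix.mulVec_mulVec, Matrix.mul_assoc]

/-! ### Equivalence of Dirichlet problems -/

/-- An equivalence between the Dirichlet problems in `Ω` for the conductivities `β` and `γ`:
compatible bijections of `L²(Ω)` and of `H¹(Ω)` that preserve the `L²` pairing, `H¹₀(Ω)` and
boundary values, and carry the energy form of `β` to that of `γ`. -/
structure DirichletEquiv (Ω : Set (E n)) (β γ : E n → Matrix (Fin n) (Fin n) ℝ) where
  onL2 : L2 Ω ℝ ≃ L2 Ω ℝ
  onH1 : H1 Ω ≃ H1 Ω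
  fn_onH1 : ∀ u, fn (onH1 u) = onL2 (fn u)
  pairing_onL2 : ∀ f g, pairing Ω (onL2 f) (onL2 g) = pairing Ω f g
  energy_onH1 : ∀ u v, energy Ω γ (onH1 u) (onH1 v) = energy Ω β u v
  onH1_mem_H10_iff : ∀ u, onH1 u ∈ H10 Ω ↔ u ∈ H10 Ω
  isTrace_onH1_iff : ∀ u f, IsTrace Ω (onH1 u) f ↔ IsTrace Ω u f

namespace DirichletEquiv

variable {β γ : E n → Matrix (Fin n) (Fin n) ℝ}

theorem dirichletSpectrum_eq (T : DirichletEquiv Ω β γ) :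
    dirichletSpectrum Ω β = dirichletSpectrum Ω γ := by
  ext lam
  refine not_congr (T.onL2.forall_congr fun {f} => T.onH1.existsUnique_congr fun {u} =>
    and_congr (T.onH1_mem_H10_iff u).symm (T.onH1.forall_congr fun {v} =>
      imp_congr (T.onH1_mem_H10_iff v).symm ?_))
  rw [T.fn_onH1, T.fn_onH1, T.pairing_onL2, T.pairing_onL2, T.energy_onH1]

theorem isWeakSolution_onH1_iff (T : DirichletEquiv Ω β γ) {lam : ℝ} {f : HHalf Ω} {u : H1 Ω} :
    IsWeakSolution Ω γ lam f (T.onH1 u) ↔ IsWeakSolution Ω β lam f u := by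
  have hequation : (∀ v ∈ H10 Ω, energy Ω β u v = lam * pairing Ω (fn u) (fn v)) ↔
      ∀ v ∈ H10 Ω, energy Ω γ (T.onH1 u) v = lam * pairing Ω (fn (T.onH1 u)) (fn v) := by
    refine T.onH1.forall_congr fun {v} => imp_congr (T.onH1_mem_H10_iff v).symm ?_
    rw [T.fn_onH1, T.fn_onH1, T.pairing_onL2, T.energy_onH1]
  exact ⟨fun h => ⟨hequation.2 h.equation, (T.isTrace_onH1_iff u f).1 h.trace⟩,
    fun h => ⟨hequation.1 h.equation, (T.isTrace_onH1_iff u f).2 h.trace⟩⟩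

theorem dnGraph_eq (T : DirichletEquiv Ω β γ) (lam : ℝ) : dnGraph Ω β lam = dnGraph Ω γ lam := by
  ext p
  refine T.onH1.exists_congr fun {u} => and_congr T.isWeakSolution_onH1_iff.symm
    (forall_congr' fun g => T.onH1.forall_congr fun {v} =>
      imp_congr (T.isTrace_onH1_iff v g).symm ?_)
  rw [T.fn_onH1, T.fn_onH1, T.pairing_onL2, T.energy_onH1]

end DirichletEquiv

theorem dnMap_congr {β γ : E n → Matrix (Fin n) (Fin n) ℝ} {lam : ℝ}
    (h : dnGraph Ω β lam = dnGraph Ω γ lam) : dnMap Ω β lam = dnMap Ω γ lam := by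
  unfold dnMap
  generalize dnGraph Ω β lam = s at h
  subst h
  rfl

/-- The equivalence of Dirichlet problems given by `u ↦ u ∘ Ψ`. -/
def IsGauge.dirichletEquiv {Ψ : E n ≃ₜ E n} (h : IsGauge Ω Ψ)
    {β γ : E n → Matrix (Fin n) (Fin n) ℝ}
    (hβ : ∀ x ∈ Ω, β (Ψ x) = jacobian Ω Ψ x * γ x * (jacobian Ω Ψ x).transpose) :
    DirichletEquiv Ω β γ where
  onL2 := ⟨h.fnPullback, h.symm.fnPullback, h.fnPullback_symm_fnPullback,
    h.symm.fnPullback_symm_fnPullback⟩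
  onH1 := ⟨h.pullback, h.symm.pullback, h.pullback_symm_pullback, h.symm.pullback_symm_pullback⟩
  fn_onH1 _ := rfl
  pairing_onL2 := h.pairing_fnPullback
  energy_onH1 := h.energy_pullback hβ
  onH1_mem_H10_iff u :=
    ⟨fun hu => h.pullback_symm_pullback u ▸ h.symm.pullback_mem_H10 hu, h.pullback_mem_H10⟩
  isTrace_onH1_iff u _ :=
    ⟨fun hu => h.pullback_symm_pullback u ▸ h.symm.isTrace_pullback hu, h.isTrace_pullback⟩

/-! ### Extension of elements of `SDiff(Ω̄)` by the identity -/

open Classical in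
/-- The extension of a self-map of `Ω̄` to `ℝⁿ` by the identity. -/
def extendById (Ω : Set (E n)) (f : E n → E n) : E n → E n := (closure Ω).piecewise f id

theorem extendById_eqOn (f : E n → E n) : EqOn (extendById Ω f) f (closure Ω) := by
  classical exact piecewise_eqOn _ _ _

theorem extendById_eqOn_id (hΩ : IsOpen Ω) {f : E n → E n} (hf : EqOn f id (frontier Ω)) :
    EqOn (extendById Ω f) id Ωᶜ := by
  intro x hx
  by_cases hc : x ∈ closure Ω
  · exact (extendById_eqOn f hc).trans (hf (hΩ.frontier_eq ▸ ⟨hc, hx⟩))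
  · simp [extendById, hc]

theorem continuous_extendById (hΩ : IsOpen Ω) {f : E n → E n} (hf : EqOn f id (frontier Ω))
    (hc : ContinuousOn f (closure Ω)) : Continuous (extendById Ω f) := by
  have hcover : closure Ω ∪ Ωᶜ = univ :=
    eq_univ_of_subset (union_subset_union_left _ subset_closure) (union_compl_self Ω)
  rw [← continuousOn_univ, ← hcover]
  exact (hc.congr (extendById_eqOn f)).union_of_isClosed
    (continuousOn_id.congr (extendById_eqOn_id hΩ hf)) isClosed_closure hΩ.isClosed_compl

theorem leftInverse_extendById {f g : E n → E n} (hg : MapsTo g (closure Ω) (closure Ω))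
    (h : LeftInvOn f g (closure Ω)) :
    Function.LeftInverse (extendById Ω f) (extendById Ω g) := by
  intro x
  by_cases hx : x ∈ closure Ω
  · rw [extendById_eqOn g hx, extendById_eqOn f (hg hx), h hx]
  · simp [extendById, hx]

namespace IsSDiff

variable {Ψ : E n → E n}

theorem leftInvOn_inverseOn (h : IsSDiff Ω Ψ) : LeftInvOn (inverseOn Ω Ψ) Ψ (closure Ω) :=
  h.bijOn.injOn.leftInvOn_invFunOn

theorem inverseOn_eqOn_id (h : IsSDiff Ω Ψ) : EqOn (inverseOn Ω Ψ) id (frontier Ω) := by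
  intro x hx
  have := h.leftInvOn_inverseOn (frontier_subset_closure hx)
  rwa [h.boundary x hx] at this

/-- The extension of `Ψ ∈ SDiff(Ω̄)` by the identity, as a homeomorphism of `ℝⁿ`. -/
def toHomeomorph (h : IsSDiff Ω Ψ) (hΩ : IsOpen Ω) : E n ≃ₜ E n where
  toFun := extendById Ω Ψ
  invFun := extendById Ω (inverseOn Ω Ψ)
  left_inv := leftInverse_extendById h.bijOn.mapsTo h.leftInvOn_inverseOn
  right_inv := leftInverse_extendById h.bijOn.surjOn.mapsTo_invFunOn
    h.bijOn.surjOn.rightInvOn_invFunOn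
  continuous_toFun := continuous_extendById hΩ h.boundary h.contDiffOn.continuousOn
  continuous_invFun := continuous_extendById hΩ h.inverseOn_eqOn_id
    h.contDiffOn_inverse.continuousOn

theorem toHomeomorph_apply (h : IsSDiff Ω Ψ) (hΩ : IsOpen Ω) {x : E n} (hx : x ∈ closure Ω) :
    h.toHomeomorph hΩ x = Ψ x :=
  extendById_eqOn Ψ hx

theorem jacobian_toHomeomorph (h : IsSDiff Ω Ψ) (hΩ : IsOpen Ω) {x : E n} (hx : x ∈ closure Ω) :
    jacobian Ω (h.toHomeomorph hΩ) x = jacobian Ω Ψ x := by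
  rw [jacobian, fderivWithin_congr (fun _ => h.toHomeomorph_apply hΩ) (h.toHomeomorph_apply hΩ hx),
    jacobian]

theorem isGauge (h : IsSDiff Ω Ψ) (hΩ : IsOpen Ω) (hb : Bornology.IsBounded Ω) :
    IsGauge Ω (h.toHomeomorph hΩ) where
  isOpen := hΩ
  isBounded := hb
  eq_self _ hx := extendById_eqOn_id hΩ h.boundary hx
  contDiffOn := h.contDiffOn.congr (extendById_eqOn Ψ)
  contDiffOn_symm := h.contDiffOn_inverse.congr (extendById_eqOn _)
  abs_det x hx := by
    rw [← h.abs_det x hx, ← h.jacobian_toHomeomorph hΩ (subset_closure hx),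
      jacobian_of_mem hΩ _ hx, LinearMap.det_toMatrix]

theorem pushforward_apply (h : IsSDiff Ω Ψ) (γ : E n → Matrix (Fin n) (Fin n) ℝ) {x : E n}
    (hx : x ∈ Ω) :
    pushforward Ω Ψ γ (Ψ x) = jacobian Ω Ψ x * γ x * (jacobian Ω Ψ x).transpose := by
  simp only [pushforward, h.leftInvOn_inverseOn (subset_closure hx), h.abs_det x hx, inv_one,
    one_smul]

/-- The equivalence of Dirichlet problems given by `u ↦ u ∘ Ψ`, for `Ψ ∈ SDiff(Ω̄)`. -/
def dirichletEquiv (h : IsSDiff Ω Ψ) (hΩ : IsOpen Ω) (hb : Bornology.IsBounded Ω)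
    (γ : E n → Matrix (Fin n) (Fin n) ℝ) : DirichletEquiv Ω (pushforward Ω Ψ γ) γ :=
  (h.isGauge hΩ hb).dirichletEquiv fun x hx => by
    rw [h.toHomeomorph_apply hΩ (subset_closure hx), h.pushforward_apply γ hx,
      h.jacobian_toHomeomorph hΩ (subset_closure hx)]

end IsSDiff

end DNGauge

end

theorem proposition1p3_general {n : ℕ} (Ω : Set (DNGauge.E n)) (hΩ : IsOpen Ω)
    (hb : Bornology.IsBounded Ω) (γ : DNGauge.E n → Matrix (Fin n) (Fin n) ℝ)
    (_hmeas : ∀ i j, Measurable fun x : closure Ω => γ x i j)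
    (_hbdd : ∃ C : ℝ, ∀ x ∈ closure Ω, ∀ i j, |γ x i j| ≤ C)
    (Ψ : DNGauge.E n → DNGauge.E n) (hΨ : DNGauge.IsSDiff Ω Ψ) :
    DNGauge.dirichletSpectrum Ω (DNGauge.pushforward Ω Ψ γ) = DNGauge.dirichletSpectrum Ω γ ∧
    ∀ lam : ℝ,
      DNGauge.dnGraph Ω (DNGauge.pushforward Ω Ψ γ) lam = DNGauge.dnGraph Ω γ lam ∧
      (lam ∉ DNGauge.dirichletSpectrum Ω γ →
        DNGauge.dnMap Ω (DNGauge.pushforward Ω Ψ γ) lam = DNGauge.dnMap Ω γ lam) := by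
  have T := hΨ.dirichletEquiv hΩ hb γ
  exact ⟨T.dirichletSpectrum_eq, fun lam =>
    ⟨T.dnGraph_eq lam, fun _ => DNGauge.dnMap_congr (T.dnGraph_eq lam)⟩⟩

theorem proposition1p3 {n : ℕ} (hn : 3 ≤ n) (Ω : Set (DNGauge.E n))
    (hΩ : DNGauge.IsSmoothBoundedDomain Ω)
    (γ : DNGauge.E n → Matrix (Fin n) (Fin n) ℝ) (hγ : DNGauge.IsConductivity Ω γ)
    (Ψ : DNGauge.E n → DNGauge.E n) (hΨ : DNGauge.IsSDiff Ω Ψ) :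
    DNGauge.dirichletSpectrum Ω (DNGauge.pushforward Ω Ψ γ) = DNGauge.dirichletSpectrum Ω γ ∧
    ∀ lam : ℝ,
      DNGauge.dnGraph Ω (DNGauge.pushforward Ω Ψ γ) lam = DNGauge.dnGraph Ω γ lam ∧
      (lam ∉ DNGauge.dirichletSpectrum Ω γ →
        DNGauge.dnMap Ω (DNGauge.pushforward Ω Ψ γ) lam = DNGauge.dnMap Ω γ lam) :=
  proposition1p3_general Ω hΩ.isOpen hΩ.isBounded γ hγ.measurable hγ.bounded Ψ hΨ
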